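/- Let $X$ be a complex Hilbert space and let $H^2(\mathbb D,X)$ be the Hilbert space of power series $f(z)=\sum_{k\ge 0}\widehat f(k)z^k$, $\widehat f(k)\in X$, with $\|f\|^2=\sum_k\|\widehat f(k)\|^2<\infty$. Let $S^*$ be the backward shift, $(S^*f)(z)=\sum_{k\ge 0}\widehat f(k+1)z^k$, and let $E_f$ be the closed linear span of $\{S^{*n}f : n\ge 0\}$. For orthogonal projections $P_1,\dots,P_{N+1}$ on $X$ put $P_k^\perp=1-P_k$, $$\Theta(z)=(P_{N+1}^\perp+zP_{N+1})\cdots(P_1^\perp+zP_1),\qquad K_\Theta=H^2(\mathbb D,X)\ominus\Theta H^2(\mathbb D,X).$$ Let $N\ge 0$ be an integer and let $F\subset H^2(\mathbb D,X)$ be a closed subspace. The following are equivalent. (i) There is a polynomial $p\in H^2(\mathbb D,X)$ of degree exactly $N$ with $F=E_p$. (ii) $\dim F=N+1$, and there are orthogonal projections $P_1,\dots,P_{N+1}$ on $X$ such that the above polynomial $\Theta$ is inner (that is, $\Theta(\zeta)$ is unitary for $|\zeta|=1$), $F=K_\Theta$ and $\dim\operatorname{Ker}\Theta(0)^*=1$.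 Moreover, let $P_1,\dots,P_{N+1}$ be orthogonal projections on $X$ such that $\dim K_\Theta=N+1$, or such that $P_k\ne 0$ for all $k$. Then $\dim\operatorname{Ker}\Theta(0)^*=1$ if and only if there are unit vectors $x_1,\dots,x_{N+1}\in X$ with $P_k=\langle\,\cdot\,,x_k\rangle x_k$ for $k=1,\dots,N+1$ and $$x_k\notin(1-P_{k+1})(1-P_{k+2})\cdots(1-P_{N+1})X\qquad\text{for } k=1,\dots,N.$$ -/

import Mathlib

open scoped ENNReal

/-- The Hardy space `H²(𝔻, X)` of power series `f(z) = ∑ f̂(k) z^k` with coefficients in `X` and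
`∑ ‖f̂(k)‖² < ∞`, with `⟨f, g⟩ = ∑ ⟨f̂(k), ĝ(k)⟩`. An element is recorded by its Taylor
coefficients: `f k` is `f̂(k)`, and the value at a point of the disc is `HardySpace.eval f z`. -/
abbrev HardySpace (X : Type*) [NormedAddCommGroup X] : Type _ :=
  lp (fun _ : ℕ => X) 2

namespace HardySpace

theorem memℓp_tail {X : Type*} [NormedAddCommGroup X] (f : HardySpace X) : Memℓp (fun k : ℕ => f (k + 1)) 2 := by
  have h := (memℓp_gen_iff (by norm_num : 0 < (2 : ℝ≥0∞).toReal)).1 (lp.memℓp f)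
  exact memℓp_gen ((summable_nat_add_iff 1).2 h)

variable {X : Type*} [NormedAddCommGroup X] [InnerProductSpace ℂ X]

/-- The value `f(z) = ∑ f̂(k) z^k`. -/
noncomputable def eval (f : HardySpace X) (z : ℂ) : X :=
  ∑' k : ℕ, z ^ k • f k

/-- The power series of `f ∈ H²(𝔻, X)` converges at every point of the unit disc. -/
theorem hasSum_eval [CompleteSpace X] (f : HardySpace X) {z : ℂ} (hz : ‖z‖ < 1) :
    HasSum (fun k : ℕ => z ^ k • f k) (eval f z) := by
  have h : Summable (fun k : ℕ => z ^ k • f k) := by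
    refine Summable.of_norm_bounded (g := fun k : ℕ => ‖z‖ ^ k * ‖f‖)
      ((summable_geometric_of_lt_one (norm_nonneg z) hz).mul_right _) ?_
    intro k
    rw [norm_smul, norm_pow]
    exact mul_le_mul_of_nonneg_left (lp.norm_apply_le_norm (by norm_num) f k) (by positivity)
  exact h.hasSum

theorem eval_add [CompleteSpace X] (f g : HardySpace X) {z : ℂ} (hz : ‖z‖ < 1) :
    eval (f + g) z = eval f z + eval g z := by
  refine (hasSum_eval (f + g) hz).unique ?_
  simpa [smul_add] using (hasSum_eval f hz).add (hasSum_eval g hz)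

theorem eval_smul [CompleteSpace X] (c : ℂ) (f : HardySpace X) {z : ℂ} (hz : ‖z‖ < 1) :
    eval (c • f) z = c • eval f z := by
  refine (hasSum_eval (c • f) hz).unique ?_
  simpa [smul_comm c] using (hasSum_eval f hz).const_smul c

theorem eval_zero (z : ℂ) : eval (0 : HardySpace X) z = 0 := by
  simp [eval]

/-- The backward shift `S^*` on `H²(𝔻, X)`: `(S^* f)(z) = ∑ f̂(k + 1) z^k`. -/
def backwardShift : HardySpace X →ₗ[ℂ] HardySpace X where
  toFun f := ⟨fun k : ℕ => f (k + 1), memℓp_tail f⟩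
  map_add' _ _ := rfl
  map_smul' _ _ := rfl

/-- `E_f`, the closed linear span of the functions `S^{*n} f`, `n ≥ 0`. -/
noncomputable def cyclicSubspace (f : HardySpace X) : Submodule ℂ (HardySpace X) :=
  (Submodule.span ℂ (Set.range fun n : ℕ => (backwardShift ^ n) f)).topologicalClosure

/-- `p` is a polynomial of degree (exactly) `N`. -/
def IsPolynomialOfDegree (p : HardySpace X) (N : ℕ) : Prop :=
  p N ≠ 0 ∧ ∀ k : ℕ, N < k → p k = 0

/-- `Θ H²(𝔻, X)`, the set of all `g ∈ H²(𝔻, X)` of the form `g(z) = Θ(z) h(z)` on the unit disc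
with `h ∈ H²(𝔻, X)`. -/
def mulRange [CompleteSpace X] (Θ : ℂ → X →L[ℂ] X) : Submodule ℂ (HardySpace X) where
  carrier := {g | ∃ h : HardySpace X, ∀ z : ℂ, ‖z‖ < 1 → eval g z = Θ z (eval h z)}
  add_mem' := by
    rintro g₁ g₂ ⟨h₁, H₁⟩ ⟨h₂, H₂⟩
    refine ⟨h₁ + h₂, fun z hz => ?_⟩
    rw [eval_add _ _ hz, eval_add _ _ hz, map_add, H₁ z hz, H₂ z hz]
  zero_mem' := ⟨0, fun z _ => by simp [eval_zero]⟩
  smul_mem' := by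
    rintro c g ⟨h, H⟩
    refine ⟨c • h, fun z hz => ?_⟩
    rw [eval_smul _ _ hz, eval_smul _ _ hz, map_smul, H z hz]

/-- `K_Θ = H²(𝔻, X) ⊖ Θ H²(𝔻, X)`. -/
noncomputable def modelSpace [CompleteSpace X] (Θ : ℂ → X →L[ℂ] X) :
    Submodule ℂ (HardySpace X) :=
  (mulRange Θ)ᗮ

end HardySpace

/-- An operator-valued polynomial `Θ` is inner if `Θ(ζ)` is unitary for every `ζ` on the unit
circle. -/
def IsInnerPolynomial {X : Type*} [NormedAddCommGroup X] [InnerProductSpace ℂ X] [CompleteSpace X]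
    (Θ : ℂ → X →L[ℂ] X) : Prop :=
  ∀ ζ : ℂ, ‖ζ‖ = 1 → Θ ζ ∈ unitary (X →L[ℂ] X)

/-- The Blaschke–Potapov product `(P_n^⊥ + z P_n) ⋯ (P_1^⊥ + z P_1)`, with indices decreasing from
left to right. The index `k : Fin n` stands for the `(k + 1)`-st projection, and
`P^⊥ = 1 - P`. -/
def blaschkePotapov {X : Type*} [NormedAddCommGroup X] [InnerProductSpace ℂ X] {n : ℕ}
    (P : Fin n → X →L[ℂ] X) (z : ℂ) : X →L[ℂ] X :=
  (List.ofFn fun k => (1 - P k) + z • P k).reverse.prod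

/-- The product `(1 - P_{k+1}) (1 - P_{k+2}) ⋯ (1 - P_n)` of the complementary projections that
follow the `k`-th one, with indices increasing from left to right; in terms of `Fin n`, which
counts from `0`, these are the projections with index `≥ k`. -/
def complTailProd {X : Type*} [NormedAddCommGroup X] [InnerProductSpace ℂ X] {n : ℕ}
    (P : Fin n → X →L[ℂ] X) (k : ℕ) : X →L[ℂ] X :=
  ((List.ofFn fun j => 1 - P j).drop k).prod

/-!
Everything rests on peeling off the outermost factor `B(z) = P^⊥ + z P` of `Θ = B Θ'`. The adjoint
of multiplication by `B` is `T = P^⊥ + S^* P`; it commutes with `S^*`, and its kernel consists of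
the constants with values in the range of `P`. Since `B Θ' H²` is the image of `Θ' H²` under
multiplication by `B`, its complement `K_Θ` is the preimage of `K_Θ'` under `T`
(`HardySpace.mem_modelSpace_succ`). By induction on the number of factors, `K_Θ` is `S^*`-invariant,
it consists of polynomials whose degree is less than the number of nonzero projections, and its
constants are the elements of `Ker Θ(0)^*`.

If `p` has degree at most `m` and `P` is the projection onto the span of the coefficient `p_m`, then
`T p` has degree less than `m`, and `E_p` is the preimage of `E_{Tp}` under `T`, because `Ker T` is
spanned by the constant `S^{*m} p`. Induction on `m` gives `E_p = K_Θ` for a suitable product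
(`HardySpace.exists_cyclicSubspace_eq_modelSpace`). If `p` has degree exactly `N`, the functions
`S^{*i} p` with `i ≤ N` have distinct degrees, so `dim E_p = N + 1`, and the constants in `E_p` form
the line through the leading coefficient, whence `dim Ker Θ(0)^* = 1`.

Conversely, if the constants in `K_Θ` form a line, all elements of `K_Θ` have leading coefficients
in that line. Subtracting multiples of the `S^{*i} p`, where `p ∈ K_Θ` has maximal degree, reduces
any element of `K_Θ` to zero (`HardySpace.exists_eq_cyclicSubspace`); so `K_Θ = E_p`, and
`dim K_Θ = N + 1` makes the degree of `p` equal to `N`.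

The last part is linear algebra for `Θ(0)^* = P_1^⊥ ⋯ P_{N+1}^⊥`. For projections `P_k ≠ 0` and a
one-dimensional kernel, removing factors from the right keeps the kernel at most one-dimensional and
shows that each `P_k` has rank one. The kernels of the tail products `P_k^⊥ ⋯ P_{N+1}^⊥` grow as `k`
decreases, starting from the line through `x_{N+1}`, and the `k`-th step is an equality exactly if
`x_k` is not in the range of the tail product that follows it. If `dim K_Θ = N + 1` is assumed
instead of `P_k ≠ 0`, then `K_Θ` contains a polynomial of degree `N`, and the degree bound on `K_Θ`
excludes a vanishing projection.
-/

namespace HardySpace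

variable {X : Type*} [NormedAddCommGroup X]

/-! ### Shifts, constants and coefficientwise operators -/

/-- The coefficients of `z f(z)`. -/
def shiftCoeff (f : ℕ → X) : ℕ → X
  | 0 => 0
  | k + 1 => f k

theorem memℓp_shiftCoeff (f : HardySpace X) : Memℓp (shiftCoeff f) 2 := by
  have h := (memℓp_gen_iff (by norm_num : 0 < (2 : ℝ≥0∞).toReal)).1 (lp.memℓp f)
  exact memℓp_gen ((summable_nat_add_iff 1).1 h)

/-- The forward shift `(S f)(z) = z f(z)`. -/
def forwardShift (f : HardySpace X) : HardySpace X :=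
  ⟨shiftCoeff f, memℓp_shiftCoeff f⟩

@[simp]
theorem forwardShift_zero (f : HardySpace X) : forwardShift f 0 = 0 := rfl

@[simp]
theorem forwardShift_succ (f : HardySpace X) (k : ℕ) : forwardShift f (k + 1) = f k := rfl

/-- The constant function with value `c`. -/
def const (c : X) : HardySpace X := lp.single 2 0 c

@[simp]
theorem const_zero (c : X) : const c 0 = c := lp.single_apply_self _ _ _

@[simp]
theorem const_succ (c : X) (k : ℕ) : const c (k + 1) = 0 :=
  lp.single_apply_ne _ _ _ (by omega)

variable [InnerProductSpace ℂ X]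

@[simp]
theorem backwardShift_apply (f : HardySpace X) (k : ℕ) : backwardShift f k = f (k + 1) := rfl

@[simp]
theorem backwardShift_pow_apply (n : ℕ) (f : HardySpace X) (k : ℕ) :
    (backwardShift ^ n) f k = f (k + n) := by
  induction n generalizing f with
  | zero => simp
  | succ n ih => rw [pow_succ, Module.End.mul_apply, ih, backwardShift_apply, add_assoc]

theorem inner_forwardShift_left (f g : HardySpace X) :
    inner ℂ (forwardShift f) g = inner ℂ f (backwardShift g) := by
  refine (lp.hasSum_inner (𝕜 := ℂ) (forwardShift f) g).unique ((hasSum_nat_add_iff' 1).1 ?_)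
  simpa using lp.hasSum_inner (𝕜 := ℂ) f (backwardShift g)

/-- A bounded operator on `X`, applied to each Taylor coefficient. -/
noncomputable def coeffMap (A : X →L[ℂ] X) : HardySpace X →ₗ[ℂ] HardySpace X :=
  (lp.mapCLM 2 (fun _ : ℕ => A) (norm_nonneg A) fun _ => le_rfl).toLinearMap

@[simp]
theorem coeffMap_apply (A : X →L[ℂ] X) (f : HardySpace X) (k : ℕ) :
    coeffMap A f k = A (f k) := rfl

/-! ### Toeplitz operators of a Blaschke–Potapov factor -/

/-- Multiplication by the factor `B(z) = P^⊥ + z P`. -/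
noncomputable def factorMul (P : X →L[ℂ] X) (h : HardySpace X) : HardySpace X :=
  coeffMap (1 - P) h + forwardShift (coeffMap P h)

/-- The adjoint `f ↦ P^⊥ f + S^* P f` of multiplication by the factor `P^⊥ + z P`, that is, the
Toeplitz operator whose symbol is the adjoint of the factor. -/
noncomputable def factorAdj (P : X →L[ℂ] X) : HardySpace X →ₗ[ℂ] HardySpace X :=
  coeffMap (1 - P) + backwardShift ∘ₗ coeffMap P

@[simp]
theorem factorAdj_apply (P : X →L[ℂ] X) (f : HardySpace X) (k : ℕ) :
    factorAdj P f k = f k - P (f k) + P (f (k + 1)) := rfl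

theorem factorAdj_backwardShift (P : X →L[ℂ] X) (f : HardySpace X) :
    factorAdj P (backwardShift f) = backwardShift (factorAdj P f) := rfl

theorem factorAdj_backwardShift_pow (P : X →L[ℂ] X) (n : ℕ) (f : HardySpace X) :
    factorAdj P ((backwardShift ^ n) f) = (backwardShift ^ n) (factorAdj P f) := by
  ext k
  simp [add_right_comm]

theorem factorAdj_const (P : X →L[ℂ] X) (c : X) : factorAdj P (const c) = const (c - P c) := by
  ext k
  cases k <;> simp

theorem _root_.blaschkePotapov_castSucc_last {n : ℕ} (P : Fin (n + 1) → X →L[ℂ] X) (z : ℂ) :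
    blaschkePotapov P z =
      ((1 - P (Fin.last n)) + z • P (Fin.last n)) * blaschkePotapov (fun i => P i.castSucc) z := by
  rw [blaschkePotapov, List.ofFn_succ', List.concat_eq_append, List.reverse_append]
  simp [blaschkePotapov]

variable [CompleteSpace X]

/-- A function in `H²(𝔻, X)` is determined by its values on the disc. -/
theorem ext_eval {f g : HardySpace X} (h : ∀ z : ℂ, ‖z‖ < 1 → eval f z = eval g z) : f = g := by
  let ps (f : HardySpace X) : FormalMultilinearSeries ℂ ℂ X := fun n =>
    ContinuousMultilinearMap.mkPiRing ℂ (Fin n) (f n)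
  have hc (f : HardySpace X) (n : ℕ) : (ps f).coeff n = f n := by
    simp [ps, FormalMultilinearSeries.coeff]
  have hball : ∀ᶠ z : ℂ in nhds 0, ‖z‖ < 1 := by
    filter_upwards [Metric.ball_mem_nhds (0 : ℂ) one_pos] with z hz using by simpa using hz
  have hps (f : HardySpace X) : HasFPowerSeriesAt (eval f) (ps f) 0 := by
    rw [hasFPowerSeriesAt_iff']
    filter_upwards [hball] with z hz
    simpa [hc] using hasSum_eval f hz
  have := (hps f).eq_formalMultilinearSeries_of_eventually (hps g)
    (hball.mono fun z hz => h z hz)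
  ext k
  rw [← hc f, this, hc]

theorem eval_forwardShift (f : HardySpace X) {z : ℂ} (hz : ‖z‖ < 1) :
    eval (forwardShift f) z = z • eval f z := by
  refine (hasSum_eval _ hz).unique ((hasSum_nat_add_iff' 1).1 ?_)
  simpa [pow_succ', mul_smul] using (hasSum_eval f hz).const_smul z

theorem eval_coeffMap (A : X →L[ℂ] X) (f : HardySpace X) {z : ℂ} (hz : ‖z‖ < 1) :
    eval (coeffMap A f) z = A (eval f z) := by
  refine (hasSum_eval _ hz).unique ?_
  simpa using A.hasSum (hasSum_eval f hz)

theorem inner_coeffMap_left {A : X →L[ℂ] X} (hA : IsSelfAdjoint A) (f g : HardySpace X) :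
    inner ℂ (coeffMap A f) g = inner ℂ f (coeffMap A g) := by
  rw [lp.inner_eq_tsum, lp.inner_eq_tsum]
  exact tsum_congr fun k => hA.isSymmetric (f k) (g k)

theorem eval_factorMul (P : X →L[ℂ] X) (h : HardySpace X) {z : ℂ} (hz : ‖z‖ < 1) :
    eval (factorMul P h) z = ((1 - P) + z • P) (eval h z) := by
  rw [factorMul, eval_add _ _ hz, eval_forwardShift _ hz, eval_coeffMap _ _ hz,
    eval_coeffMap _ _ hz]
  rfl

theorem inner_factorMul_left {P : X →L[ℂ] X} (hP : IsStarProjection P) (h f : HardySpace X) :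
    inner ℂ (factorMul P h) f = inner ℂ h (factorAdj P f) := by
  rw [factorMul, inner_add_left, inner_forwardShift_left, inner_coeffMap_left hP.isSelfAdjoint,
    inner_coeffMap_left hP.one_sub.isSelfAdjoint, ← inner_add_right]
  rfl

/-- The summands of `P^⊥ f + S^* P f` take values in orthogonal subspaces, so a coefficient of the
sum vanishes only if those of both summands do. -/
theorem apply_eq_of_factorAdj_apply_eq_zero {P : X →L[ℂ] X} (hP : IsStarProjection P)
    {f : HardySpace X} {k : ℕ} (h : factorAdj P f k = 0) : P (f k) = f k ∧ P (f (k + 1)) = 0 := by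
  have hPP (y : X) : P (P y) = P y := DFunLike.congr_fun hP.isIdempotentElem.eq y
  rw [factorAdj_apply] at h
  have h1 : P (f (k + 1)) = 0 := by simpa [hPP] using congrArg P h
  refine ⟨?_, h1⟩
  rw [h1, add_zero, sub_eq_zero] at h
  exact h.symm

/-! ### Model spaces of Blaschke–Potapov products -/

theorem exists_eval_eq_blaschkePotapov {n : ℕ} (P : Fin n → X →L[ℂ] X) (h : HardySpace X) :
    ∃ g : HardySpace X, ∀ z : ℂ, ‖z‖ < 1 → eval g z = blaschkePotapov P z (eval h z) := by
  induction n with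
  | zero => exact ⟨h, fun z _ => by simp [blaschkePotapov]⟩
  | succ n ih =>
    obtain ⟨g, hg⟩ := ih fun i => P i.castSucc
    refine ⟨factorMul (P (Fin.last n)) g, fun z hz => ?_⟩
    rw [eval_factorMul _ _ hz, hg z hz, blaschkePotapov_castSucc_last]
    rfl

theorem modelSpace_blaschkePotapov_zero (P : Fin 0 → X →L[ℂ] X) :
    modelSpace (blaschkePotapov P) = ⊥ := by
  have : mulRange (blaschkePotapov P) = ⊤ :=
    eq_top_iff.2 fun h _ => ⟨h, fun z _ => by simp [blaschkePotapov]⟩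
  rw [modelSpace, this, Submodule.top_orthogonal_eq_bot]

/-- Peeling off the outermost factor `B` of `Θ = B Θ'`: the model space `K_Θ` is the preimage of
`K_Θ'` under the adjoint of multiplication by `B`. -/
theorem mem_modelSpace_succ {n : ℕ} {P : Fin (n + 1) → X →L[ℂ] X}
    (hP : IsStarProjection (P (Fin.last n))) (f : HardySpace X) :
    f ∈ modelSpace (blaschkePotapov P) ↔
      factorAdj (P (Fin.last n)) f ∈ modelSpace (blaschkePotapov fun i => P i.castSucc) := by
  rw [modelSpace, modelSpace, Submodule.mem_orthogonal, Submodule.mem_orthogonal]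
  constructor
  · rintro H g ⟨h, hg⟩
    rw [← inner_factorMul_left hP]
    refine H _ ⟨h, fun z hz => ?_⟩
    rw [eval_factorMul _ _ hz, hg z hz, blaschkePotapov_castSucc_last]
    rfl
  · rintro H g ⟨h, hg⟩
    obtain ⟨g', hg'⟩ := exists_eval_eq_blaschkePotapov (fun i => P i.castSucc) h
    have : g = factorMul (P (Fin.last n)) g' := ext_eval fun z hz => by
      rw [eval_factorMul _ _ hz, hg' z hz, hg z hz, blaschkePotapov_castSucc_last]
      rfl
    rw [this, inner_factorMul_left hP]
    exact H _ ⟨h, hg'⟩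

theorem backwardShift_mem_modelSpace {n : ℕ} {P : Fin n → X →L[ℂ] X}
    (hP : ∀ k, IsStarProjection (P k)) {f : HardySpace X}
    (hf : f ∈ modelSpace (blaschkePotapov P)) :
    backwardShift f ∈ modelSpace (blaschkePotapov P) := by
  induction n generalizing f with
  | zero =>
    rw [modelSpace_blaschkePotapov_zero, Submodule.mem_bot] at hf ⊢
    rw [hf, map_zero]
  | succ n ih =>
    rw [mem_modelSpace_succ (hP _)] at hf ⊢
    rw [factorAdj_backwardShift]
    exact ih (fun k => hP _) hf

/-- Functions in `K_Θ` are polynomials whose degree is less than the number of nonzero projections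
in the product `Θ`. -/
theorem apply_eq_zero_of_mem_modelSpace {n : ℕ} {P : Fin n → X →L[ℂ] X}
    (hP : ∀ k, IsStarProjection (P k)) {f : HardySpace X}
    (hf : f ∈ modelSpace (blaschkePotapov P)) {k : ℕ}
    (hk : {i | P i ≠ 0}.ncard ≤ k) : f k = 0 := by
  classical
  rw [Set.ncard_eq_toFinset_card', Set.toFinset_ofPred, Finset.card_filter] at hk
  induction n generalizing f k with
  | zero =>
    rw [modelSpace_blaschkePotapov_zero, Submodule.mem_bot] at hf
    simp [hf]
  | succ n ih =>
    rw [mem_modelSpace_succ (hP _)] at hf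
    rw [Fin.sum_univ_castSucc] at hk
    by_cases h0 : P (Fin.last n) = 0
    · simpa [h0] using ih (fun _ => hP _) hf (k := k) (by simpa [h0] using hk)
    · rw [if_pos h0] at hk
      obtain ⟨j, rfl⟩ : ∃ j, k = j + 1 := ⟨k - 1, by omega⟩
      rw [← (apply_eq_of_factorAdj_apply_eq_zero (hP _)
        (ih (fun _ => hP _) hf (k := j + 1) (by omega))).1]
      exact (apply_eq_of_factorAdj_apply_eq_zero (hP _)
        (ih (fun _ => hP _) hf (k := j) (by omega))).2

theorem const_mem_modelSpace_iff {n : ℕ} {P : Fin n → X →L[ℂ] X}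
    (hP : ∀ k, IsStarProjection (P k)) (c : X) :
    const c ∈ modelSpace (blaschkePotapov P) ↔
      c ∈ (ContinuousLinearMap.adjoint (blaschkePotapov P 0)).ker := by
  induction n generalizing c with
  | zero =>
    rw [modelSpace_blaschkePotapov_zero, Submodule.mem_bot, ← ContinuousLinearMap.star_eq_adjoint]
    suffices const c = 0 ↔ c = 0 by simpa [blaschkePotapov]
    exact ⟨fun h => by rw [← const_zero c, h]; rfl, fun h => by rw [h]; exact lp.single_zero _ _⟩
  | succ n ih =>
    rw [mem_modelSpace_succ (hP _), factorAdj_const, ih fun _ => hP _,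
      blaschkePotapov_castSucc_last, ← ContinuousLinearMap.star_eq_adjoint,
      ← ContinuousLinearMap.star_eq_adjoint, star_mul, zero_smul, add_zero,
      (hP _).one_sub.isSelfAdjoint.star_eq]
    rfl

end HardySpace

theorem isInnerPolynomial_blaschkePotapov {X : Type*} [NormedAddCommGroup X]
    [InnerProductSpace ℂ X] [CompleteSpace X] {n : ℕ} {P : Fin n → X →L[ℂ] X}
    (hP : ∀ k, IsStarProjection (P k)) : IsInnerPolynomial (blaschkePotapov P) := by
  intro ζ hζ
  refine Submonoid.list_prod_mem _ fun A hA => ?_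
  simp only [List.mem_reverse, List.mem_ofFn] at hA
  obtain ⟨k, rfl⟩ := hA
  have h1 : P k * P k = P k := (hP k).isIdempotentElem
  have h2 : star (P k) = P k := (hP k).isSelfAdjoint
  have h3 : ζ * starRingEnd ℂ ζ = 1 := by simpa [hζ] using Complex.mul_conj' ζ
  have h4 : ζ • (starRingEnd ℂ ζ • P k) = P k := by
    ext y
    change ζ • starRingEnd ℂ ζ • P k y = P k y
    rw [smul_smul, h3, one_smul]
  have h5 : starRingEnd ℂ ζ • (ζ • P k) = P k := by
    ext y
    change starRingEnd ℂ ζ • ζ • P k y = P k y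
    rw [smul_smul, mul_comm, h3, one_smul]
  rw [Unitary.mem_iff]
  simp only [star_add, star_sub, star_one, star_smul, h2, mul_add, add_mul, mul_sub, sub_mul,
    one_mul, mul_one, smul_mul_assoc, mul_smul_comm, h1]
  simp [h4, h5]

namespace HardySpace

/-! ### Cyclic subspaces generated by polynomials -/

section Cyclic

variable {X : Type*} [NormedAddCommGroup X] [InnerProductSpace ℂ X]

/-- The orbit of `p` under the backward shift consists of its first `m` terms and zeros. -/
theorem span_orbit_eq {p : HardySpace X} {m : ℕ} (hp : ∀ k, m ≤ k → p k = 0) :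
    Submodule.span ℂ (Set.range fun n : ℕ => (backwardShift ^ n) p) =
      Submodule.span ℂ (Set.range fun n : Fin m => (backwardShift ^ (n : ℕ)) p) := by
  apply le_antisymm
  · rw [Submodule.span_le]
    rintro _ ⟨n, rfl⟩
    by_cases hn : n < m
    · exact Submodule.subset_span ⟨⟨n, hn⟩, rfl⟩
    · have : (backwardShift ^ n) p = 0 := by
        ext k
        rw [backwardShift_pow_apply, hp _ (by omega)]
        rfl
      simp [this]
  · exact Submodule.span_mono (Set.range_subset_iff.2 fun n => ⟨n, rfl⟩)

/-- For a polynomial the span of the orbit is finite-dimensional, hence already closed. -/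
theorem cyclicSubspace_eq_span {p : HardySpace X} {m : ℕ} (hp : ∀ k, m ≤ k → p k = 0) :
    cyclicSubspace p = Submodule.span ℂ (Set.range fun n : ℕ => (backwardShift ^ n) p) := by
  rw [cyclicSubspace, span_orbit_eq hp]
  have := FiniteDimensional.span_of_finite ℂ
    (Set.finite_range fun n : Fin m => (backwardShift ^ (n : ℕ)) p)
  exact (Submodule.closed_of_finiteDimensional _).submodule_topologicalClosure_eq

theorem pow_backwardShift_mem_cyclicSubspace (p : HardySpace X) (n : ℕ) :
    (backwardShift ^ n) p ∈ cyclicSubspace p :=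
  Submodule.le_topologicalClosure _ (Submodule.subset_span ⟨n, rfl⟩)

theorem sum_smul_pow_backwardShift_apply {m : ℕ} (c : Fin m → ℂ) (p : HardySpace X) (k : ℕ) :
    (∑ i, c i • (backwardShift ^ (i : ℕ)) p) k = ∑ i, c i • p (k + i) := by
  rw [lp.coeFn_sum]
  refine (Finset.sum_apply k _ _).trans (Finset.sum_congr rfl fun i _ => ?_)
  rw [lp.coeFn_smul, Pi.smul_apply, backwardShift_pow_apply]

/-- The functions `S^{*i} p` with `i ≤ N` have the distinct degrees `N - i`; so the coefficients
from the `j`-th on of a linear combination determine the scalars with `i + j ≤ N`. -/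
theorem IsPolynomialOfDegree.coeff_eq_zero {p : HardySpace X} {N : ℕ}
    (hp : p.IsPolynomialOfDegree N) {c : Fin (N + 1) → ℂ} {j : ℕ}
    (h : ∀ k, j ≤ k → ∑ i, c i • p (k + i) = 0) (i : Fin (N + 1)) (hi : (i : ℕ) + j ≤ N) :
    c i = 0 := by
  obtain ⟨i, hiN⟩ := i
  induction i using Nat.strong_induction_on with
  | _ i ih =>
    simp only at hi
    have hs := h (N - i) (by omega)
    -- in degree `N - i` the terms of higher index vanish, as their degree is smaller
    rw [Finset.sum_eq_single ⟨i, hiN⟩] at hs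
    · rw [show N - i + (⟨i, hiN⟩ : Fin (N + 1)) = N by simp; omega] at hs
      exact (smul_eq_zero.1 hs).resolve_right hp.1
    · rintro ⟨l, hl⟩ - hne
      rcases lt_or_gt_of_ne (show l ≠ i by simpa using hne) with hlt | hgt
      · rw [ih l hlt hl (by simp only; omega), zero_smul]
      · rw [hp.2 _ (by simp only; omega), smul_zero]
    · simp

theorem IsPolynomialOfDegree.linearIndependent {p : HardySpace X} {N : ℕ}
    (hp : p.IsPolynomialOfDegree N) :
    LinearIndependent ℂ fun n : Fin (N + 1) => (backwardShift ^ (n : ℕ)) p := by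
  rw [Fintype.linearIndependent_iff]
  intro c hc i
  refine hp.coeff_eq_zero (j := 0) (fun k _ => ?_) i (by omega)
  rw [← sum_smul_pow_backwardShift_apply, hc]
  rfl

theorem IsPolynomialOfDegree.finrank_cyclicSubspace {p : HardySpace X} {N : ℕ}
    (hp : p.IsPolynomialOfDegree N) : Module.finrank ℂ p.cyclicSubspace = N + 1 := by
  rw [cyclicSubspace_eq_span (m := N + 1) fun k hk => hp.2 k hk,
    span_orbit_eq (m := N + 1) fun k hk => hp.2 k hk, finrank_span_eq_card hp.linearIndependent,
    Fintype.card_fin]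

theorem backwardShift_pow_eq_const {p : HardySpace X} {N : ℕ}
    (hp : ∀ k, N < k → p k = 0) : (backwardShift ^ N) p = const (p N) := by
  ext k
  rw [backwardShift_pow_apply]
  cases k with
  | zero => simp
  | succ k => rw [hp _ (by omega), const_succ]

/-- The constants in `E_p` are the multiples of the leading coefficient of `p`. -/
theorem IsPolynomialOfDegree.const_mem_cyclicSubspace_iff {p : HardySpace X} {N : ℕ}
    (hp : p.IsPolynomialOfDegree N) (c : X) :
    const c ∈ p.cyclicSubspace ↔ c ∈ Submodule.span ℂ {p N} := by
  rw [Submodule.mem_span_singleton]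
  constructor
  · intro h
    rw [cyclicSubspace_eq_span (m := N + 1) fun k hk => hp.2 k hk,
      span_orbit_eq (m := N + 1) fun k hk => hp.2 k hk,
      Submodule.mem_span_range_iff_exists_fun] at h
    obtain ⟨a, ha⟩ := h
    have hk (k : ℕ) : ∑ i, a i • p (k + i) = const c k := by
      rw [← ha, sum_smul_pow_backwardShift_apply]
    have h0 (i : Fin (N + 1)) (hi : i ≠ Fin.last N) : a i = 0 := by
      refine hp.coeff_eq_zero (j := 1) (fun k hk1 => ?_) i ?_
      · obtain ⟨k, rfl⟩ : ∃ l, k = l + 1 := ⟨k - 1, by omega⟩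
        rw [hk, const_succ]
      · have := Fin.val_lt_last hi
        omega
    refine ⟨a (Fin.last N), ?_⟩
    have := hk 0
    rw [Finset.sum_eq_single (Fin.last N) (fun i _ hi => by rw [h0 i hi, zero_smul]) (by simp),
      const_zero] at this
    simpa using this
  · rintro ⟨a, rfl⟩
    have h : const (a • p N) = a • (backwardShift ^ N) p := by
      rw [backwardShift_pow_eq_const hp.2]
      exact lp.single_smul _ _ _ _
    rw [h]
    exact Submodule.smul_mem _ _ (pow_backwardShift_mem_cyclicSubspace p N)

/-- Let `P` be the projection onto the line spanned by the top coefficient of `p`. Then `E_p` is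
the preimage of `E_{p'}` under `P^⊥ + S^* P`, where `p' = P^⊥ p + S^* P p`: this operator commutes
with `S^*`, and its kernel, the constants with values in that line, is contained in `E_p`. -/
theorem cyclicSubspace_eq_comap_factorAdj [CompleteSpace X] {p : HardySpace X} {m : ℕ}
    (hp : ∀ k, m < k → p k = 0) {P : X →L[ℂ] X} (hP : IsStarProjection P)
    (hrange : ∀ y, P y ∈ Submodule.span ℂ {p m}) (hpm : P (p m) = p m) :
    (∀ k, m ≤ k → factorAdj P p k = 0) ∧
      ∀ f, f ∈ p.cyclicSubspace ↔ factorAdj P f ∈ (factorAdj P p).cyclicSubspace := by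
  have hp' (k : ℕ) (hk : m ≤ k) : factorAdj P p k = 0 := by
    rw [factorAdj_apply, hp (k + 1) (by omega)]
    obtain rfl | hk := hk.eq_or_lt
    · simp [hpm]
    · simp [hp k hk]
  refine ⟨hp', fun f => ?_⟩
  have hmap : (factorAdj P p).cyclicSubspace = p.cyclicSubspace.map (factorAdj P) := by
    rw [cyclicSubspace_eq_span hp', cyclicSubspace_eq_span (m := m + 1) hp, Submodule.map_span,
      ← Set.range_comp]
    simp only [Function.comp_def, factorAdj_backwardShift_pow]
  have hker : (factorAdj P).ker ≤ p.cyclicSubspace := by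
    intro g hg
    have hg' (k : ℕ) := apply_eq_of_factorAdj_apply_eq_zero hP
      (show factorAdj P g k = 0 by rw [LinearMap.mem_ker.1 hg]; rfl)
    obtain ⟨a, ha⟩ := Submodule.mem_span_singleton.1 ((hg' 0).1 ▸ hrange (g 0))
    have : g = a • (backwardShift ^ m) p := by
      rw [backwardShift_pow_eq_const hp]
      ext k
      cases k with
      | zero => simpa using ha.symm
      | succ k => rw [← (hg' (k + 1)).1, (hg' k).2]; simp
    rw [this]
    exact Submodule.smul_mem _ _ (pow_backwardShift_mem_cyclicSubspace p m)
  rw [hmap, ← Submodule.mem_comap, Submodule.comap_map_eq, sup_eq_left.2 hker]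

/-- Every `E_p` with `p` a polynomial is the model space of a Blaschke–Potapov product; the
outermost projection is the one onto the line spanned by the top coefficient of `p`. -/
theorem exists_cyclicSubspace_eq_modelSpace [CompleteSpace X] {p : HardySpace X} {m : ℕ}
    (hp : ∀ k, m ≤ k → p k = 0) :
    ∃ P : Fin m → X →L[ℂ] X, (∀ k, IsStarProjection (P k)) ∧
      p.cyclicSubspace = modelSpace (blaschkePotapov P) := by
  induction m generalizing p with
  | zero =>
    refine ⟨fun k => k.elim0, fun k => k.elim0, ?_⟩
    have : p = 0 := by
      ext k
      simpa using hp k (by omega)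
    rw [modelSpace_blaschkePotapov_zero, cyclicSubspace_eq_span hp, this]
    simp
  | succ m ih =>
    let U := Submodule.span ℂ {p m}
    obtain ⟨hp', hmem⟩ := cyclicSubspace_eq_comap_factorAdj (m := m) hp
      (isStarProjection_starProjection (U := U)) (fun y => U.starProjection_apply_mem y)
      (Submodule.starProjection_eq_self_iff.2 (Submodule.mem_span_singleton_self _))
    obtain ⟨P, hP, hPE⟩ := ih hp'
    refine ⟨Fin.snoc P U.starProjection, fun k => ?_, ?_⟩
    · refine Fin.lastCases ?_ (fun i => ?_) k
      · simp
      · simpa using hP i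
    · ext f
      rw [mem_modelSpace_succ (by simp), hmem, hPE]
      simp

/-- An `S^*`-invariant space of polynomials whose constants all lie in one line is generated by any
of its elements of maximal degree. -/
theorem exists_eq_cyclicSubspace {F : Submodule ℂ (HardySpace X)}
    (hF : ∀ f ∈ F, backwardShift f ∈ F) (hFc : IsClosed (F : Set (HardySpace X))) (hF0 : F ≠ ⊥)
    {n : ℕ} (hdeg : ∀ f ∈ F, ∀ k, n ≤ k → f k = 0) {v : X}
    (hconst : ∀ c, const c ∈ F → c ∈ Submodule.span ℂ {v}) :
    ∃ (m : ℕ) (p : HardySpace X), p.IsPolynomialOfDegree m ∧ F = p.cyclicSubspace := by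
  classical
  have hpow (i : ℕ) : ∀ f ∈ F, (backwardShift ^ i) f ∈ F := by
    induction i with
    | zero => simp
    | succ i ih =>
      intro f hf
      rw [pow_succ, Module.End.mul_apply]
      exact ih _ (hF f hf)
  have hex : ∃ n, ∀ f ∈ F, ∀ k, n ≤ k → f k = 0 := ⟨n, hdeg⟩
  obtain ⟨m, hm⟩ : ∃ m, Nat.find hex = m + 1 := by
    refine Nat.exists_eq_succ_of_ne_zero fun h0 => hF0 ((Submodule.eq_bot_iff _).2 fun f hf => ?_)
    ext k
    exact Nat.find_spec hex f hf k (by omega)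
  have hlt : ∀ f ∈ F, ∀ k, m < k → f k = 0 := fun f hf k hk =>
    Nat.find_spec hex f hf k (by omega)
  obtain ⟨p, hpF, hpm⟩ : ∃ p ∈ F, p m ≠ 0 := by
    have := Nat.find_min hex (m := m) (by omega)
    push Not at this
    obtain ⟨p, hpF, k, hk, hne⟩ := this
    obtain rfl | hk := hk.eq_or_lt
    · exact ⟨p, hpF, hne⟩
    · exact absurd (hlt p hpF k hk) hne
  have hp : p.IsPolynomialOfDegree m := ⟨hpm, hlt p hpF⟩
  have hle : p.cyclicSubspace ≤ F :=
    Submodule.topologicalClosure_minimal _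
      (Submodule.span_le.2 (Set.range_subset_iff.2 fun i => hpow i p hpF)) hFc
  -- the leading coefficient of every element of `F` is a multiple of the one of `p`
  have hlead (f : HardySpace X) (hf : f ∈ F) (j : ℕ) (hj : ∀ k, j < k → f k = 0) :
      ∃ a : ℂ, a • p m = f j := by
    have key (g : HardySpace X) (hg : g ∈ F) (j : ℕ) (hj : ∀ k, j < k → g k = 0) :=
      Submodule.mem_span_singleton.1
        (hconst (g j) (backwardShift_pow_eq_const hj ▸ hpow j g hg))
    obtain ⟨a, ha⟩ := key f hf j hj
    obtain ⟨b, hb⟩ := key p hpF m hp.2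
    have hb0 : b ≠ 0 := by
      rintro rfl
      exact hpm (by rw [← hb, zero_smul])
    exact ⟨a * b⁻¹, by rw [← hb, ← ha, smul_smul, inv_mul_cancel_right₀ hb0]⟩
  refine ⟨m, p, hp, le_antisymm ?_ hle⟩
  suffices H : ∀ j ≤ m + 1, ∀ f ∈ F, (∀ k, j ≤ k → f k = 0) → f ∈ p.cyclicSubspace from
    fun f hf => H (m + 1) le_rfl f hf (hlt f hf)
  intro j
  induction j with
  | zero =>
    intro _ f _ hf
    have : f = 0 := by
      ext k
      exact hf k (by omega)
    exact this ▸ Submodule.zero_mem _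
  | succ j ih =>
    intro hj f hfF hf
    obtain ⟨a, ha⟩ := hlead f hfF j hf
    have hmem := Submodule.smul_mem _ a (pow_backwardShift_mem_cyclicSubspace p (m - j))
    rw [← Submodule.sub_mem_iff_left _ hmem]
    refine ih (by omega) _ (Submodule.sub_mem _ hfF (hle hmem)) fun k hk => ?_
    have hk' : (f - a • (backwardShift ^ (m - j)) p) k = f k - a • p (k + (m - j)) := by
      rw [← backwardShift_pow_apply]
      rfl
    rw [hk']
    obtain rfl | hk := hk.eq_or_lt
    · rw [show j + (m - j) = m by omega, ha, sub_self]
    · rw [hf k hk, hp.2 _ (by omega), smul_zero, sub_zero]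

end Cyclic

end HardySpace

/-! ### Products of complementary projections -/

section ComplTailProd

variable {X : Type*} [NormedAddCommGroup X] [InnerProductSpace ℂ X]

theorem complTailProd_eq_mul {n : ℕ} (P : Fin n → X →L[ℂ] X) (k : Fin n) :
    complTailProd P k = (1 - P k) * complTailProd P (k + 1) := by
  rw [complTailProd, List.drop_eq_getElem_cons (by simp), List.prod_cons, complTailProd]
  simp

theorem complTailProd_self {n : ℕ} (P : Fin n → X →L[ℂ] X) : complTailProd P n = 1 := by
  rw [complTailProd, List.drop_of_length_le (by simp), List.prod_nil]

theorem complTailProd_zero_castSucc_last {n : ℕ} (P : Fin (n + 1) → X →L[ℂ] X) :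
    complTailProd P 0 = complTailProd (fun i => P i.castSucc) 0 * (1 - P (Fin.last n)) := by
  rw [complTailProd, List.ofFn_succ', List.concat_eq_append]
  simp [complTailProd]

theorem complTailProd_apply_eq_zero {n : ℕ} (P : Fin n → X →L[ℂ] X) {i j : ℕ} (hij : i ≤ j)
    (hj : j ≤ n) {y : X} (hy : complTailProd P j y = 0) : complTailProd P i y = 0 := by
  induction hij using Nat.decreasingInduction with
  | self => exact hy
  | of_succ i hi ih =>
    rw [complTailProd_eq_mul P ⟨i, by omega⟩]
    change (1 - P _) (complTailProd P (i + 1) y) = 0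
    rw [ih, map_zero]

/-- The kernels of the tail products `P_{k+1}^⊥ ⋯ P_{N+1}^⊥` increase as `k` decreases, from the
line spanned by `x_{N+1}`. If the kernel of the full product is a line, none of these inclusions
is strict, so no `x_k` is in the range of the tail product that follows it. -/
theorem notMem_range_complTailProd {N : ℕ} {P : Fin (N + 1) → X →L[ℂ] X}
    (h : Module.rank ℂ (complTailProd P 0).ker ≤ 1) {x : Fin (N + 1) → X}
    (hx : ∀ k, ‖x k‖ = 1 ∧ ∀ y : X, P k y = inner ℂ (x k) y • x k) (k : Fin (N + 1))
    (hk : (k : ℕ) < N) : x k ∉ (complTailProd P ((k : ℕ) + 1)).range := by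
  have hne (k) : x k ≠ 0 := fun h => by simpa [h] using (hx k).1
  have hPx (k) : (1 - P k) (x k) = 0 := by
    change x k - P k (x k) = 0
    rw [(hx k).2, inner_self_eq_norm_sq_to_K, (hx k).1]
    simp
  obtain ⟨v, -, hv⟩ := (rank_submodule_le_one_iff _).1 h
  have hlast : complTailProd P N (x (Fin.last N)) = 0 := by
    have := complTailProd_eq_mul P (Fin.last N)
    rw [Fin.val_last, complTailProd_self, mul_one] at this
    rw [this, hPx]
  rintro ⟨y, hy⟩
  have hTy : complTailProd P k y = 0 := by
    rw [complTailProd_eq_mul]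
    exact (congrArg (fun u => (1 - P k) u) hy).trans (hPx k)
  obtain ⟨a, ha⟩ := Submodule.mem_span_singleton.1
    (hv (LinearMap.mem_ker.2 (complTailProd_apply_eq_zero P (Nat.zero_le _) (by omega) hTy)))
  obtain ⟨b, hb⟩ := Submodule.mem_span_singleton.1
    (hv (LinearMap.mem_ker.2 (complTailProd_apply_eq_zero P (Nat.zero_le _) (by omega) hlast)))
  have hb0 : b ≠ 0 := by
    rintro rfl
    exact hne _ (by rw [← hb, zero_smul])
  have hyx : y = (a * b⁻¹) • x (Fin.last N) := by
    rw [← hb, smul_smul, inv_mul_cancel_right₀ hb0, ha]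
  have hy0 : complTailProd P (k + 1) y = 0 := by
    rw [hyx, map_smul, complTailProd_apply_eq_zero P (by omega) (by omega) hlast, smul_zero]
  exact hne k (hy.symm.trans hy0)

/-- If no `x_k` is in the range of the tail product that follows it, each factor `P_k^⊥` is
injective on that range, so prepending it does not enlarge the kernel. -/
theorem ker_complTailProd_eq_span {N : ℕ} {P : Fin (N + 1) → X →L[ℂ] X} {x : Fin (N + 1) → X}
    (hx : ∀ k, ‖x k‖ = 1 ∧ ∀ y : X, P k y = inner ℂ (x k) y • x k)
    (hrange : ∀ k : Fin (N + 1), (k : ℕ) < N → x k ∉ (complTailProd P ((k : ℕ) + 1)).range) :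
    (complTailProd P 0).ker = Submodule.span ℂ {x (Fin.last N)} := by
  have hlast : complTailProd P N = 1 - P (Fin.last N) := by
    have := complTailProd_eq_mul P (Fin.last N)
    rwa [Fin.val_last, complTailProd_self, mul_one] at this
  apply le_antisymm
  · suffices H : ∀ i ≤ N, ∀ y, complTailProd P i y = 0 → y ∈ Submodule.span ℂ {x (Fin.last N)} from
      fun y hy => H 0 (Nat.zero_le _) y hy
    intro i hi
    induction hi using Nat.decreasingInduction with
    | self =>
      intro y hy
      rw [hlast] at hy
      have hy' : y = P (Fin.last N) y := sub_eq_zero.1 hy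
      rw [hy', (hx _).2]
      exact Submodule.smul_mem _ _ (Submodule.mem_span_singleton_self _)
    | of_succ i hi ih =>
      intro y hy
      refine ih y ?_
      let k : Fin (N + 1) := ⟨i, by omega⟩
      let w := complTailProd P (i + 1) y
      have hw : w = inner ℂ (x k) w • x k := by
        rw [← (hx k).2]
        have := complTailProd_eq_mul P k
        exact sub_eq_zero.1 ((DFunLike.congr_fun this y).symm.trans hy)
      by_cases hc : inner ℂ (x k) w = 0
      · change w = 0
        rw [hw, hc, zero_smul]
      · refine absurd ⟨(inner ℂ (x k) w)⁻¹ • y, ?_⟩ (hrange k hi)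
        change complTailProd P (i + 1) ((inner ℂ (x k) w)⁻¹ • y) = x k
        rw [map_smul, inv_smul_eq_iff₀ hc]
        exact hw
  · rw [Submodule.span_singleton_le_iff_mem, LinearMap.mem_ker]
    refine complTailProd_apply_eq_zero P (Nat.zero_le N) (by omega) ?_
    rw [hlast]
    change x _ - P _ (x _) = 0
    rw [(hx _).2, inner_self_eq_norm_sq_to_K, (hx _).1]
    simp

variable [CompleteSpace X]

theorem adjoint_blaschkePotapov_zero {n : ℕ} {P : Fin n → X →L[ℂ] X}
    (hP : ∀ k, IsStarProjection (P k)) :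
    ContinuousLinearMap.adjoint (blaschkePotapov P 0) = complTailProd P 0 := by
  induction n with
  | zero => simp [blaschkePotapov, complTailProd, ← ContinuousLinearMap.star_eq_adjoint]
  | succ n ih =>
    rw [complTailProd_zero_castSucc_last, ← ih fun k => hP _, blaschkePotapov_castSucc_last,
      ← ContinuousLinearMap.star_eq_adjoint, star_mul, zero_smul, add_zero,
      (hP _).one_sub.isSelfAdjoint.star_eq, ContinuousLinearMap.star_eq_adjoint]

/-- A nonzero orthogonal projection with range in a line is `⟨·, x⟩ x` for some unit vector `x`. -/
theorem IsStarProjection.exists_eq_inner_smul {P : X →L[ℂ] X} (hP : IsStarProjection P)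
    (h0 : P ≠ 0) {v : X} (hv : ∀ y, P y ∈ Submodule.span ℂ {v}) :
    ∃ x : X, ‖x‖ = 1 ∧ ∀ y, P y = inner ℂ x y • x := by
  have hPP (y : X) : P (P y) = P y := DFunLike.congr_fun hP.isIdempotentElem.eq y
  obtain ⟨y₀, hy₀⟩ : ∃ y, P y ≠ 0 := by
    by_contra! h
    exact h0 (ContinuousLinearMap.ext h)
  have hn : (‖P y₀‖ : ℂ) ≠ 0 := by simpa using hy₀
  let x : X := (‖P y₀‖ : ℂ)⁻¹ • P y₀
  have hx1 : ‖x‖ = 1 := by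
    rw [norm_smul, norm_inv, Complex.norm_real, norm_norm, inv_mul_cancel₀ (by simpa using hy₀)]
  have hPx : P x = x := by rw [map_smul, hPP]
  refine ⟨x, hx1, fun y => ?_⟩
  obtain ⟨c, hc⟩ := Submodule.mem_span_singleton.1 (hv y)
  obtain ⟨d, hd⟩ := Submodule.mem_span_singleton.1 (hv y₀)
  have hd0 : d ≠ 0 := by
    rintro rfl
    exact hy₀ (by rw [← hd, zero_smul])
  have hyx : P y = (c * d⁻¹ * ‖P y₀‖) • x := by
    rw [smul_smul, mul_inv_cancel_right₀ hn, ← hd, smul_smul, inv_mul_cancel_right₀ hd0, hc]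
  have hin : inner ℂ x y = inner ℂ x (P y) := by
    have := hP.isSelfAdjoint.isSymmetric x y
    rwa [ContinuousLinearMap.coe_coe, hPx] at this
  rw [hin, hyx, inner_smul_right, inner_self_eq_norm_sq_to_K, hx1]
  simp

/-- If `A (1 - P)` has a kernel of dimension at most one, so has `A`: a vector of `Ker A` that `P`
annihilates lies in `Ker A (1 - P)`, which is the range of `P`; so `P` is injective on `Ker A`. -/
theorem IsStarProjection.rank_ker_le_one {A P : X →L[ℂ] X} (hP : IsStarProjection P)
    (h0 : P ≠ 0) (h : Module.rank ℂ (A * (1 - P)).ker ≤ 1) :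
    (∃ x : X, ‖x‖ = 1 ∧ ∀ y, P y = inner ℂ x y • x) ∧ Module.rank ℂ A.ker ≤ 1 := by
  have hPP (y : X) : P (P y) = P y := DFunLike.congr_fun hP.isIdempotentElem.eq y
  obtain ⟨v, -, hv⟩ := (rank_submodule_le_one_iff _).1 h
  have hmem (y : X) (hy : A (y - P y) = 0) : y ∈ Submodule.span ℂ {v} :=
    hv (LinearMap.mem_ker.2 hy)
  obtain ⟨x, hx1, hx⟩ := hP.exists_eq_inner_smul h0 (v := v) fun y => hmem _ (by simp [hPP])
  refine ⟨⟨x, hx1, hx⟩, ?_⟩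
  have hPx : P x = x := by
    rw [hx, inner_self_eq_norm_sq_to_K, hx1]
    simp
  have hx0 : x ≠ 0 := by
    rintro rfl
    simp at hx1
  obtain ⟨b, hb⟩ := Submodule.mem_span_singleton.1 (hmem x (by simp [hPx]))
  have hb0 : b ≠ 0 := by
    rintro rfl
    exact hx0 (by rw [← hb, zero_smul])
  let φ : A.ker →ₗ[ℂ] ℂ := (innerSL ℂ x).toLinearMap ∘ₗ A.ker.subtype
  have hφ : Function.Injective φ := by
    rw [← LinearMap.ker_eq_bot, LinearMap.ker_eq_bot']
    rintro ⟨w, hw⟩ hφw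
    have hPw : P w = 0 := by rw [hx, show inner ℂ x w = 0 from hφw, zero_smul]
    have hAw : A w = 0 := hw
    obtain ⟨a, ha⟩ := Submodule.mem_span_singleton.1 (hmem w (by rw [hPw, sub_zero, hAw]))
    have hwx : w = (a * b⁻¹) • x := by
      rw [← hb, smul_smul, inv_mul_cancel_right₀ hb0, ha]
    have : P w = w := by rw [hwx, map_smul, hPx]
    exact Subtype.ext (this.symm.trans hPw)
  simpa using LinearMap.lift_rank_le_of_injective φ hφ

theorem exists_eq_inner_smul_of_rank_ker_le_one {n : ℕ} {P : Fin n → X →L[ℂ] X}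
    (hP : ∀ k, IsStarProjection (P k)) (h0 : ∀ k, P k ≠ 0)
    (h : Module.rank ℂ (complTailProd P 0).ker ≤ 1) (k : Fin n) :
    ∃ x : X, ‖x‖ = 1 ∧ ∀ y, P k y = inner ℂ x y • x := by
  induction n with
  | zero => exact k.elim0
  | succ n ih =>
    rw [complTailProd_zero_castSucc_last] at h
    obtain ⟨hlast, hrest⟩ := (hP _).rank_ker_le_one (h0 _) h
    refine Fin.lastCases hlast (fun i => ?_) k
    exact ih (fun _ => hP _) (fun _ => h0 _) hrest i

end ComplTailProd

/-! ### Model spaces generated by a polynomial -/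

namespace HardySpace

variable {X : Type*} [NormedAddCommGroup X] [InnerProductSpace ℂ X] [CompleteSpace X]

theorem exists_modelSpace_eq_cyclicSubspace {N : ℕ} {P : Fin (N + 1) → X →L[ℂ] X}
    (hP : ∀ k, IsStarProjection (P k))
    (hdim : Module.finrank ℂ (modelSpace (blaschkePotapov P)) = N + 1)
    (hker : Module.finrank ℂ (ContinuousLinearMap.adjoint (blaschkePotapov P 0)).ker = 1) :
    ∃ p : HardySpace X, p.IsPolynomialOfDegree N ∧
      modelSpace (blaschkePotapov P) = p.cyclicSubspace := by
  obtain ⟨v, -, hv⟩ := (rank_submodule_le_one_iff _).1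
    (Module.rank_eq_one_iff_finrank_eq_one.2 hker).le
  obtain ⟨m, p, hp, hE⟩ := exists_eq_cyclicSubspace (F := modelSpace (blaschkePotapov P))
    (fun f hf => backwardShift_mem_modelSpace hP hf) (Submodule.isClosed_orthogonal _)
    (fun h => by rw [h, finrank_bot] at hdim; omega)
    (fun f hf k hk => apply_eq_zero_of_mem_modelSpace hP hf hk)
    (fun c hc => hv ((const_mem_modelSpace_iff hP c).1 hc))
  have : m = N := by
    rw [hE, hp.finrank_cyclicSubspace] at hdim
    omega
  exact ⟨p, this ▸ hp, hE⟩

/-- If `K_Θ` contains a polynomial of degree `N`, then none of the `N + 1` projections in the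
product `Θ` vanishes, by the degree bound on `K_Θ`. -/
theorem ne_zero_of_mem_modelSpace {N : ℕ} {P : Fin (N + 1) → X →L[ℂ] X}
    (hP : ∀ k, IsStarProjection (P k)) {p : HardySpace X}
    (hp : p ∈ modelSpace (blaschkePotapov P)) (hpN : p N ≠ 0) (k : Fin (N + 1)) : P k ≠ 0 := by
  intro hk
  refine hpN (apply_eq_zero_of_mem_modelSpace hP hp ?_)
  have : {i | P i ≠ 0}.ncard < (Set.univ : Set (Fin (N + 1))).ncard :=
    Set.ncard_lt_ncard (Set.ssubset_univ_iff.2 fun h =>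
      (show k ∈ {i | P i ≠ 0} from h ▸ Set.mem_univ k) hk)
  rw [Set.ncard_univ, Nat.card_fin] at this
  omega

end HardySpace

theorem mainTheorem6 {X : Type*} [NormedAddCommGroup X] [InnerProductSpace ℂ X] [CompleteSpace X]
    (N : ℕ) :
    (∀ F : Submodule ℂ (HardySpace X), IsClosed (F : Set (HardySpace X)) →
      ((∃ p : HardySpace X, p.IsPolynomialOfDegree N ∧ F = p.cyclicSubspace) ↔
        (Module.finrank ℂ F = N + 1 ∧
          ∃ P : Fin (N + 1) → X →L[ℂ] X,
            (∀ k, IsStarProjection (P k)) ∧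
            IsInnerPolynomial (blaschkePotapov P) ∧
            F = HardySpace.modelSpace (blaschkePotapov P) ∧
            Module.finrank ℂ (ContinuousLinearMap.adjoint (blaschkePotapov P 0)).ker = 1))) ∧
    (∀ P : Fin (N + 1) → X →L[ℂ] X,
      (∀ k, IsStarProjection (P k)) →
      (Module.finrank ℂ (HardySpace.modelSpace (blaschkePotapov P)) = N + 1 ∨ ∀ k, P k ≠ 0) →
      (Module.finrank ℂ (ContinuousLinearMap.adjoint (blaschkePotapov P 0)).ker = 1 ↔
        ∃ x : Fin (N + 1) → X,
          (∀ k, ‖x k‖ = 1 ∧ ∀ y : X, P k y = inner ℂ (x k) y • x k) ∧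
          ∀ k : Fin (N + 1), (k : ℕ) < N →
            x k ∉ (complTailProd P ((k : ℕ) + 1)).range)) := by
  refine ⟨fun F _ => ⟨?_, ?_⟩, fun P hP h => ⟨fun hker => ?_, ?_⟩⟩
  · rintro ⟨p, hp, rfl⟩
    obtain ⟨P, hP, hE⟩ :=
      HardySpace.exists_cyclicSubspace_eq_modelSpace (m := N + 1) fun k hk => hp.2 k hk
    refine ⟨hp.finrank_cyclicSubspace, P, hP, isInnerPolynomial_blaschkePotapov hP, hE, ?_⟩
    have : (ContinuousLinearMap.adjoint (blaschkePotapov P 0)).ker = Submodule.span ℂ {p N} := by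
      ext c
      rw [← HardySpace.const_mem_modelSpace_iff hP, ← hE, hp.const_mem_cyclicSubspace_iff]
    rw [this, finrank_span_singleton hp.1]
  · rintro ⟨hdim, P, hP, -, rfl, hker⟩
    exact HardySpace.exists_modelSpace_eq_cyclicSubspace hP hdim hker
  · have h0 : ∀ k, P k ≠ 0 := by
      refine h.elim (fun hdim => ?_) id
      obtain ⟨p, hp, hE⟩ := HardySpace.exists_modelSpace_eq_cyclicSubspace hP hdim hker
      exact HardySpace.ne_zero_of_mem_modelSpace hP
        (hE ▸ HardySpace.pow_backwardShift_mem_cyclicSubspace p 0) hp.1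
    rw [adjoint_blaschkePotapov_zero hP] at hker
    have hrank := (Module.rank_eq_one_iff_finrank_eq_one.2 hker).le
    choose x hx using exists_eq_inner_smul_of_rank_ker_le_one hP h0 hrank
    exact ⟨x, hx, notMem_range_complTailProd hrank hx⟩
  · rintro ⟨x, hx, hrange⟩
    rw [adjoint_blaschkePotapov_zero hP, ker_complTailProd_eq_span hx hrange]
    refine finrank_span_singleton fun h => ?_
    simpa [h] using (hx (Fin.last N)).1
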